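/- For a finite simple graph $G$ let $\lambda_{\min}(G)$ denote the least eigenvalue of its adjacency matrix, let $G^c$ be its complement, and let the vertex connectivity of $G$ be the least number of vertices whose deletion leaves a disconnected graph or at most one vertex (so that $K_n$ has connectivity $n-1$). For integers $a,b\ge \kappa$ let $B_1(a,b;\kappa)$ be the graph obtained from disjoint complete graphs $K_a$ and $K_b$ by adding $\kappa$ pairwise disjoint edges between $V(K_a)$ and $V(K_b)$ (a $\kappa$-matching). **Theorem 3.2.** Let $\kappa\ge 1$ and $n\ge 2\kappa$ be integers. Then $B_1(\lceil n/2\rceil,\lfloor n/2\rfloor;\kappa)$ is a connected graph on $n$ vertices with vertex connectivity $\kappa$, and every connected graph $G$ on $n$ vertices with vertex connectivity $\kappa$ satisfies $$\lambda_{\min}(G^c)\;\ge\;\lambda_{\min}\bigl(B_1(\lceil n/2\rceil,\lfloor n/2\rfloor;\kappa)^c\bigr).$$ That is, $B_1(\lceil n/2\rceil,\lfloor n/2\rfloor;\kappa)$ attains the minimum of $\lambda_{\min}(G^c)$ over all connected graphs $G$ on $n$ vertices with vertex connectivity $\kappa$. -/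

import Mathlib

namespace SimpleGraph

/-- The vertex connectivity of a finite graph: the least number of vertices whose deletion leaves a
disconnected graph or at most one vertex. The second alternative matters only for complete graphs,
where it gives the usual value `n - 1`; any other graph on `n` vertices has a disconnecting set
of at most `n - 2` vertices. -/
noncomputable def vertexConnectivity {V : Type*} [Fintype V] (G : SimpleGraph V) : ℕ :=
  sInf {k : ℕ | ∃ S : Finset V, S.card = k ∧
    (¬ (G.induce {v | v ∉ S}).Preconnected ∨ Fintype.card V ≤ k + 1)}

open Classical in
/-- The least eigenvalue of the real adjacency matrix of a finite graph. The set of eigenvalues is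
finite, and it is nonempty when the graph has a vertex (the matrix being symmetric), so the infimum
is then a minimum. -/
noncomputable def leastEigenvalue {V : Type*} [Fintype V] (G : SimpleGraph V) : ℝ :=
  sInf {μ : ℝ | Module.End.HasEigenvalue (G.adjMatrix ℝ).mulVecLin μ}

/-- Adjacency in `cliquesWithMatching`. -/
def cliquesWithMatchingAdj (a b k : ℕ) : Fin a ⊕ Fin b → Fin a ⊕ Fin b → Prop
  | .inl i, .inl j => i ≠ j
  | .inr i, .inr j => i ≠ j
  | .inl i, .inr j => i.val = j.val ∧ i.val < k
  | .inr j, .inl i => i.val = j.val ∧ i.val < k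

/-- For `k ≤ min a b`, the graph `B₁(a, b; k)`: disjoint complete graphs on `a` and on `b` vertices
joined by a matching with `k` edges, the `i`-th vertex of the first being joined to the
`i`-th vertex of the second for `i < k`. -/
def cliquesWithMatching (a b k : ℕ) : SimpleGraph (Fin a ⊕ Fin b) where
  Adj := cliquesWithMatchingAdj a b k
  symm := ⟨by
    rintro (i | i) (j | j) h
    · exact Ne.symm h
    · exact h
    · exact h
    · exact Ne.symm h⟩
  loopless := ⟨by
    rintro (i | i) h
    · exact h rfl
    · exact h rfl⟩

end SimpleGraph

/-!
Write `k` for the connectivity, `a = ⌈n/2⌉`, `b = ⌊n/2⌋`. The complement of `B₁(a, b; k)` is the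
bipartite graph `K_{a,b}` minus a `k`-matching, and its eigenvectors constant on the matched and on
the unmatched vertices of each part have eigenvalues `±ρ` with
`ρ⁴ - (ab - 2k + 1)ρ² + (a - k)(b - k) = 0`. Taking the largest root `ρ²` gives
`λ_min(B₁(a, b; k)ᶜ) ≤ -ρ` (`leastEigenvalue_compl_cliquesWithMatching_le`).

For the bound `-ρ ≤ λ_min(Gᶜ)`, let `x` be an eigenvector of `Gᶜ` and split the vertices by the sign
of `x`. Edges inside a part contribute nonnegatively to the quadratic form, so only the bipartite
graph `H` of edges of `Gᶜ` across the cut matters, and by AM-GM its spectral radius is at most `ρ`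
as soon as there are positive weights `w` with `∑_{v ∼ u} w v ≤ ρ w u` in `H`
(`neg_le_leastEigenvalue_of_hasCutWeights`). Such weights exist for every cut:

* If some part has `s` vertices with `s (n - k - 1) ≤ ρ²`, degrees suffice, because every vertex of
  `Gᶜ` has degree at most `n - k - 1` (`hasCutWeights_of_card_mul_le`). This covers all parts with
  fewer than `k` vertices, and single vertices when `k = 1`, since `k (n - k - 2) + 1 ≤ ρ²`.
* Otherwise both parts have at least `max k 2` vertices. As no set of fewer than `k` vertices
  separates `G`, Hall's theorem yields a `k`-matching of `G` across the cut
  (`exists_matching_of_le_vertexConnectivity`), so `H` lies in `K_{s,t}` minus a `k`-matching with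
  `s + t = n`. The eigenvector formula for `K_{s,t}` evaluated at the same `ρ` gives the weights
  (`hasCutWeights_compl_of_matching`): the required inequality is that the quadratic above with
  `st` in place of `ab` is nonnegative at `ρ²`, which holds because `st ≤ ab` and `ρ² ≥ 1`.
-/
namespace SimpleGraph

/-! ### Vertex connectivity, separating sets and matchings -/

section Connectivity

variable {V : Type*} [Fintype V] {G : SimpleGraph V}

open Classical in
theorem vertexConnectivity_le_card_compl_of_not_adj {X Y : Finset V} (hX : X.Nonempty)
    (hY : Y.Nonempty) (hXY : Disjoint X Y) (h : ∀ u ∈ X, ∀ v ∈ Y, ¬ G.Adj u v) :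
    G.vertexConnectivity ≤ (X ∪ Y)ᶜ.card := by
  refine Nat.sInf_le ⟨(X ∪ Y)ᶜ, rfl, Or.inl fun hpre => ?_⟩
  obtain ⟨x, hx⟩ := hX
  obtain ⟨y, hy⟩ := hY
  obtain ⟨p⟩ := hpre ⟨x, by simp [hx]⟩ ⟨y, by simp [hy]⟩
  have key : ∀ (u v : {v | v ∉ (X ∪ Y)ᶜ}), (G.induce {v | v ∉ (X ∪ Y)ᶜ}).Walk u v →
      u.1 ∈ X → v.1 ∈ X := by
    intro u v p
    induction p with
    | nil => exact id
    | @cons u v w huv _ ih =>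
      intro hu
      refine ih ?_
      have hv : v.1 ∉ X → v.1 ∈ Y := by simpa using v.2
      exact by_contra fun hv' => h _ hu _ (hv hv') huv
  exact Finset.disjoint_left.1 hXY (key _ _ p hx) hy

open Classical in
/-- Deleting the neighbours of `v` isolates `v`, or leaves `v` alone. -/
theorem vertexConnectivity_le_degree (v : V) : G.vertexConnectivity ≤ G.degree v := by
  by_cases hY : (insert v (G.neighborFinset v))ᶜ.Nonempty
  · refine (vertexConnectivity_le_card_compl_of_not_adj (X := {v}) (by simp) hY (by simp)
      (by simp +contextual)).trans (Finset.card_le_card fun w hw => ?_)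
    simp only [Finset.mem_compl, Finset.mem_union, Finset.mem_singleton, Finset.mem_insert,
      mem_neighborFinset] at hw ⊢
    tauto
  · rw [Finset.not_nonempty_iff_eq_empty, Finset.compl_eq_empty_iff] at hY
    refine Nat.sInf_le ⟨G.neighborFinset v, rfl, Or.inr ?_⟩
    rw [← Finset.card_univ, ← hY, ← G.card_neighborFinset_eq_degree v]
    exact Finset.card_insert_le _ _

open Classical in
/-- The part of Menger's theorem that concerns a bipartition: across any cut `(L, Lᶜ)` with at least
`k` vertices on each side, a graph of connectivity at least `k` has `k` disjoint edges. This is the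
defect form of Hall's theorem, obtained by adding `#L - k` dummy vertices to `Lᶜ`, each adjacent
to all of `L`. -/
theorem exists_matching_of_le_vertexConnectivity {k : ℕ} (hk : k ≤ G.vertexConnectivity)
    {L : Finset V} (hL : k ≤ L.card) (hR : k ≤ Lᶜ.card) :
    ∃ p q : Fin k ↪ V, (∀ i, p i ∈ L) ∧ (∀ i, q i ∉ L) ∧ ∀ i, G.Adj (p i) (q i) := by
  set d := L.card - k with hd
  let t : L → Finset (V ⊕ Fin d) := fun l =>
    (Lᶜ.filter (G.Adj l)).disjSum Finset.univ
  have hall : ∀ s : Finset L, s.card ≤ (s.biUnion t).card := by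
    intro s
    rcases s.eq_empty_or_nonempty with rfl | ⟨l, hl⟩
    · simp
    let X : Finset V := s.map (Function.Embedding.subtype _)
    let N : Finset V := Lᶜ.filter fun v => ∃ u ∈ X, G.Adj u v
    have hX : X.card = s.card := Finset.card_map _
    have hXL : X ⊆ L := fun u hu => by
      obtain ⟨l, _, rfl⟩ := Finset.mem_map.1 hu
      exact l.2
    have hsub : N.disjSum Finset.univ ⊆ s.biUnion t := by
      rintro (v | i) hv
      · simp only [Finset.inl_mem_disjSum, N, X, Finset.mem_filter, Finset.mem_map] at hv
        obtain ⟨hv, _, ⟨u, hu, rfl⟩, huv⟩ := hv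
        exact Finset.mem_biUnion.2 ⟨u, hu, Finset.inl_mem_disjSum.2 (Finset.mem_filter.2 ⟨hv, huv⟩)⟩
      · exact Finset.mem_biUnion.2 ⟨l, hl, by simp [t]⟩
    have hcard := Finset.card_le_card hsub
    rw [Finset.card_disjSum, Finset.card_univ, Fintype.card_fin] at hcard
    -- `(L \ X) ∪ N` meets every edge between `L` and its complement
    have hcover : k ≤ (L \ X).card + N.card := by
      by_cases hN : (Lᶜ \ N).Nonempty
      · refine hk.trans ((vertexConnectivity_le_card_compl_of_not_adj (X := X) (Y := Lᶜ \ N)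
          ⟨l, Finset.mem_map_of_mem _ hl⟩ hN ?_ ?_).trans
          ((Finset.card_le_card ?_).trans (Finset.card_union_le _ _)))
        · exact Finset.disjoint_left.2 fun u hu hu' => by simp [hXL hu] at hu'
        · intro u hu v hv huv
          simp only [Finset.mem_sdiff, N, Finset.mem_filter] at hv
          exact hv.2 ⟨hv.1, u, hu, huv⟩
        · intro u hu
          simp only [Finset.mem_compl, Finset.mem_union, Finset.mem_sdiff] at hu ⊢
          tauto
      · rw [Finset.not_nonempty_iff_eq_empty, Finset.sdiff_eq_empty_iff_subset] at hN
        exact hR.trans ((Finset.card_le_card hN).trans (Nat.le_add_left _ _))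
    have := Finset.card_sdiff_add_card_eq_card hXL
    omega
  obtain ⟨f, hf, hft⟩ := (Finset.all_card_le_biUnion_card_iff_exists_injective t).1 hall
  -- at most `d` vertices of `L` are sent to one of the dummy vertices `Fin d`
  let S : Finset L := Finset.univ.filter fun l => (f l).isLeft
  have hS : k ≤ S.card := by
    have h1 : Sᶜ.card ≤ d := by
      have : Sᶜ.map ⟨f, hf⟩ ⊆ Finset.univ.map (Function.Embedding.inr : Fin d ↪ V ⊕ Fin d) := by
        intro z hz
        obtain ⟨l, hl, rfl⟩ := Finset.mem_map.1 hz
        rcases h : f l with v | i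
        · simp [S, h] at hl
        · simp [h]
      simpa using Finset.card_le_card this
    have h2 := Finset.card_add_card_compl S
    rw [Fintype.card_coe] at h2
    omega
  obtain ⟨e⟩ : Nonempty (Fin k ↪ S) :=
    Function.Embedding.nonempty_of_card_le (by simpa using hS)
  have hq : ∀ i, ∃ v, f (e i).1 = Sum.inl v := fun i => by
    have := (Finset.mem_filter.1 (e i).2).2
    exact Sum.isLeft_iff.1 this
  choose q hq using hq
  have hmem : ∀ i, q i ∉ L ∧ G.Adj (e i).1 (q i) := fun i => by
    simpa [hq, t] using hft (e i).1
  refine ⟨⟨fun i => (e i).1.1, fun i j hij => e.injective (Subtype.ext (Subtype.ext hij))⟩,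
    ⟨q, fun i j hij => e.injective (Subtype.ext (hf ?_))⟩, fun i => (e i).1.2,
    fun i => (hmem i).1, fun i => (hmem i).2⟩
  rw [hq, hq, hij]

end Connectivity

/-! ### Connectivity of two cliques joined by a matching -/

section Cliques

variable {a b k : ℕ}

/-- A set of vertices containing both ends of some matching edge induces a connected subgraph. -/
theorem cliquesWithMatching_induce_preconnected {T : Set (Fin a ⊕ Fin b)} {i : ℕ} (ha : i < a)
    (hb : i < b) (hik : i < k) (hl : Sum.inl ⟨i, ha⟩ ∈ T) (hr : Sum.inr ⟨i, hb⟩ ∈ T) :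
    ((cliquesWithMatching a b k).induce T).Preconnected := by
  have key : ∀ v : T, ((cliquesWithMatching a b k).induce T).Reachable v ⟨_, hl⟩ := by
    have hrl : ((cliquesWithMatching a b k).induce T).Reachable ⟨_, hr⟩ ⟨_, hl⟩ :=
      Adj.reachable (G := (cliquesWithMatching a b k).induce T) ⟨rfl, hik⟩
    rintro ⟨j | j, hj⟩
    · by_cases h : j = ⟨i, ha⟩
      · subst h; rfl
      · exact Adj.reachable (G := (cliquesWithMatching a b k).induce T) h
    · by_cases h : j = ⟨i, hb⟩
      · subst h; exact hrl
      · exact (Adj.reachable (G := (cliquesWithMatching a b k).induce T)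
          (u := ⟨_, hj⟩) (v := ⟨_, hr⟩) h).trans hrl
  exact fun u v => (key u).trans (key v).symm

theorem cliquesWithMatching_connected (ha : k ≤ a) (hb : k ≤ b) (hk : 1 ≤ k) :
    (cliquesWithMatching a b k).Connected := by
  have : Nonempty (Fin a ⊕ Fin b) := ⟨Sum.inl ⟨0, by omega⟩⟩
  refine ⟨(induceUnivIso _).preconnected_iff.1 ?_⟩
  exact cliquesWithMatching_induce_preconnected (i := 0) (by omega) (by omega) (by omega)
    trivial trivial

theorem le_vertexConnectivity_cliquesWithMatching (ha : k ≤ a) (hb : k ≤ b) (hk : 1 ≤ k) :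
    k ≤ (cliquesWithMatching a b k).vertexConnectivity := by
  refine le_csInf ⟨_, Finset.univ, rfl, Or.inr (by simp)⟩ ?_
  rintro _ ⟨S, rfl, hS⟩
  by_contra! hlt
  rcases hS with hS | hS
  · -- fewer than `k` deleted vertices miss one of the `k` matching edges
    obtain ⟨i, hl, hr⟩ : ∃ i : Fin k, Sum.inl (Fin.castLE ha i) ∉ S ∧
        Sum.inr (Fin.castLE hb i) ∉ S := by
      by_contra! h
      classical
      let f : Fin k → Fin a ⊕ Fin b := fun i =>
        if Sum.inl (Fin.castLE ha i) ∈ S then Sum.inl (Fin.castLE ha i)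
        else Sum.inr (Fin.castLE hb i)
      have hf : Function.Injective f := fun i j hij => by
        simp only [f] at hij
        split_ifs at hij <;> simpa using hij
      have hfS : ∀ i, f i ∈ S := fun i => by
        simp only [f]
        split_ifs with hi
        · exact hi
        · exact h i hi
      have := Finset.card_le_card_of_injOn (s := Finset.univ) f (fun i _ => hfS i) hf.injOn
      simp at this
      omega
    exact hS (cliquesWithMatching_induce_preconnected (i.2.trans_le ha) (i.2.trans_le hb) i.2 hl hr)
  · simp at hS
    omega

theorem vertexConnectivity_cliquesWithMatching_le (ha : k ≤ a) (hb : k ≤ b) (hk : 1 ≤ k)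
    (hba : b ≤ a) : (cliquesWithMatching a b k).vertexConnectivity ≤ k := by
  classical
  rcases ha.eq_or_lt with rfl | ha
  · -- here both cliques have `k` vertices and every vertex has degree `k`
    refine (vertexConnectivity_le_degree (Sum.inl ⟨0, by omega⟩)).trans ?_
    rw [← card_neighborFinset_eq_degree]
    refine (Finset.card_le_card (t := (Finset.univ.erase ⟨0, by omega⟩).disjSum
      {⟨0, by omega⟩}) ?_).trans ?_
    · rintro (j | j) hj
      · have : (⟨0, by omega⟩ : Fin k) ≠ j := (mem_neighborFinset _ _ _).1 hj
        simpa using this.symm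
      · have : 0 = j.1 ∧ 0 < k := (mem_neighborFinset _ _ _).1 hj
        simp [this.1]
    · rw [Finset.card_disjSum, Finset.card_erase_of_mem (Finset.mem_univ _)]
      simp
      omega
  · refine (vertexConnectivity_le_card_compl_of_not_adj
      (X := (Finset.univ.filter fun i : Fin a => k ≤ i.1).disjSum ∅)
      (Y := (∅ : Finset (Fin a)).disjSum (Finset.univ : Finset (Fin b)))
      ⟨Sum.inl ⟨k, ha⟩, by simp⟩ ⟨Sum.inr ⟨0, by omega⟩, by simp⟩ ?_ ?_).trans ?_
    · rw [Finset.disjoint_left]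
      rintro (i | i) <;> simp
    · rintro (i | i) hi (j | j) hj h
      · simp at hj
      · have h : i.1 = j.1 ∧ i.1 < k := h
        have hi : k ≤ i.1 := by simpa using hi
        omega
      · simp at hj
      · simp at hi
    · refine (Finset.card_le_card (t := Finset.univ.image
        fun i : Fin k => (Sum.inl (Fin.castLE ha.le i) : Fin a ⊕ Fin b)) ?_).trans
        (Finset.card_image_le.trans (by simp))
      rintro (i | i) hi
      · have hi : i.1 < k := by simpa using hi
        exact Finset.mem_image.2 ⟨⟨i.1, hi⟩, by simp, by simp⟩
      · simp at hi

end Cliques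

/-! ### Bounds on the least eigenvalue -/

section Spectral

variable {V : Type*} [Fintype V] {G : SimpleGraph V}

theorem leastEigenvalue_le_of_mulVec_eq [DecidableRel G.Adj] {μ : ℝ} {x : V → ℝ} (hx : x ≠ 0)
    (h : (G.adjMatrix ℝ).mulVec x = μ • x) : G.leastEigenvalue ≤ μ := by
  classical
  refine csInf_le (Module.End.finite_hasEigenvalue _).bddBelow ?_
  refine Module.End.hasEigenvalue_of_hasEigenvector (x := x)
    ⟨Module.End.mem_eigenspace_iff.2 ?_, hx⟩
  rw [Matrix.mulVecLin_apply, ← h]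
  congr!

open Classical in
/-- `G.HasCutWeights ρ L`: there are positive vertex weights `w` such that, in the bipartite graph
of the edges of `G` between `L` and `Lᶜ`, the neighbours of each vertex `u` have total weight at most
`ρ * w u`. This bounds the spectral radius of that bipartite graph by `ρ`. -/
def HasCutWeights (G : SimpleGraph V) (ρ : ℝ) (L : Finset V) : Prop :=
  ∃ w : V → ℝ, (∀ v, 0 < w v) ∧
    ∀ u, ∑ v with G.Adj u v ∧ (u ∈ L ↔ v ∉ L), w v ≤ ρ * w u

open Classical in
theorem HasCutWeights.of_compl {ρ : ℝ} {L : Finset V} (h : G.HasCutWeights ρ Lᶜ) :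
    G.HasCutWeights ρ L := by
  obtain ⟨w, hw, h⟩ := h
  refine ⟨w, hw, fun u => ?_⟩
  convert h u using 4
  simp only [Finset.mem_compl]
  tauto

/-- The relevant cut for an eigenvector is the one given by the signs of its entries. -/
theorem neg_le_leastEigenvalue_of_hasCutWeights {ρ : ℝ} (hρ : 0 ≤ ρ)
    (h : ∀ L : Finset V, G.HasCutWeights ρ L) : -ρ ≤ G.leastEigenvalue := by
  classical
  -- `0 ≤ ρ` covers the junk value `0` of the infimum when there are no eigenvalues
  refine Real.le_sInf (fun μ hμ => ?_) (by linarith)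
  obtain ⟨x, hx⟩ := hμ.exists_hasEigenvector
  have hx0 : x ≠ 0 := hx.2
  have hpos : 0 < ∑ u, x u ^ 2 := by
    obtain ⟨u, hu⟩ := Function.ne_iff.1 hx0
    exact Finset.sum_pos' (fun _ _ => sq_nonneg _) ⟨u, Finset.mem_univ _, sq_pos_of_ne_zero hu⟩
  have hAx : ∀ u, ∑ v, (if G.Adj u v then x v else 0) = μ * x u := fun u => by
    have := congrFun (Module.End.mem_eigenspace_iff.1 hx.1) u
    simpa [Matrix.mulVec, dotProduct, adjMatrix_apply] using this
  obtain ⟨w, hw, hsum⟩ := h (Finset.univ.filter fun v => 0 ≤ x v)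
  obtain ⟨H, hH⟩ : ∃ H : V → V → Prop, ∀ u v, H u v ↔ G.Adj u v ∧ (0 ≤ x u ↔ ¬ 0 ≤ x v) :=
    ⟨_, fun _ _ => Iff.rfl⟩
  replace hsum : ∀ u, ∑ v with H u v, w v ≤ ρ * w u := fun u => by
    simpa [hH] using hsum u
  have hHsymm : ∀ u v, H u v ↔ H v u := fun u v => by
    rw [hH, hH, G.adj_comm u v]
    tauto
  -- the edges inside a part contribute nonnegatively, those across are bounded by AM-GM
  have hpt : ∀ u v, 0 ≤ (if G.Adj u v then 2 * (x u * x v) else 0) +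
      ((if H u v then w v / w u * x u ^ 2 else 0) + (if H v u then w u / w v * x v ^ 2 else 0)) := by
    intro u v
    simp only [hHsymm v u]
    by_cases hadj : G.Adj u v
    · have hu := hw u
      have hv := hw v
      by_cases hc : H u v
      · simp only [hadj, hc, if_true]
        have : 2 * (x u * x v) + (w v / w u * x u ^ 2 + w u / w v * x v ^ 2) =
            (w v * x u + w u * x v) ^ 2 / (w u * w v) := by
          field_simp
          ring
        rw [this]
        positivity
      · simp only [hadj, hc, if_true, if_false, add_zero]
        have : ¬ (0 ≤ x u ↔ ¬ 0 ≤ x v) := fun h => hc ((hH u v).2 ⟨hadj, h⟩)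
        by_cases h1 : 0 ≤ x u
        · have : 0 ≤ x v := by tauto
          positivity
        · have : ¬ 0 ≤ x v := by tauto
          have := mul_pos_of_neg_of_neg (not_le.1 h1) (not_le.1 this)
          linarith
    · simp [hadj, hH]
  have hB : ∑ u, ∑ v, (if H u v then w v / w u * x u ^ 2 else 0) ≤ ρ * ∑ u, x u ^ 2 := by
    rw [Finset.mul_sum]
    refine Finset.sum_le_sum fun u _ => ?_
    rw [← Finset.sum_filter]
    have : ∑ v with H u v, w v / w u * x u ^ 2 = (∑ v with H u v, w v) / w u * x u ^ 2 := by
      rw [Finset.sum_div, Finset.sum_mul]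
    rw [this]
    exact mul_le_mul_of_nonneg_right ((div_le_iff₀ (hw u)).2 (hsum u)) (sq_nonneg _)
  have hA : ∑ u, ∑ v, (if G.Adj u v then 2 * (x u * x v) else 0) = 2 * (μ * ∑ u, x u ^ 2) := by
    rw [Finset.mul_sum, Finset.mul_sum]
    refine Finset.sum_congr rfl fun u _ => ?_
    have : ∑ v, (if G.Adj u v then 2 * (x u * x v) else 0) =
        2 * x u * ∑ v, (if G.Adj u v then x v else 0) := by
      rw [Finset.mul_sum]
      refine Finset.sum_congr rfl fun v _ => ?_
      split_ifs <;> ring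
    rw [this, hAx]
    ring
  have htot : 0 ≤ ∑ u, ∑ v, ((if G.Adj u v then 2 * (x u * x v) else 0) +
      ((if H u v then w v / w u * x u ^ 2 else 0) +
        (if H v u then w u / w v * x v ^ 2 else 0))) :=
    Finset.sum_nonneg fun u _ => Finset.sum_nonneg fun v _ => hpt u v
  have hcomm := Finset.sum_comm (s := Finset.univ) (t := Finset.univ)
    (f := fun u v => if H v u then w u / w v * x v ^ 2 else 0)
  simp only [Finset.sum_add_distrib] at htot
  rw [hA, hcomm] at htot
  have : 0 ≤ (μ + ρ) * ∑ u, x u ^ 2 := by linarith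
  linarith [nonneg_of_mul_nonneg_left this hpos]

end Spectral

/-! ### Elementary inequalities -/

section Quadratic

/-- A monic quadratic that is nonpositive at `t` has a root to the right of `t`. -/
theorem exists_quadratic_root_ge {q c t : ℝ} (h : t ^ 2 - q * t + c ≤ 0) :
    ∃ θ, t ≤ θ ∧ θ ^ 2 - q * θ + c = 0 := by
  have hD : (2 * t - q) ^ 2 ≤ q ^ 2 - 4 * c := by linarith
  refine ⟨(q + √(q ^ 2 - 4 * c)) / 2, ?_, ?_⟩
  · linarith [Real.le_sqrt_of_sq_le hD]
  · linarith [Real.sq_sqrt ((sq_nonneg _).trans hD)]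

theorem mul_le_mul_of_balanced {a b c d : ℕ} (h : a + b = c + d) (hba : b ≤ a) (hab : a ≤ b + 1) :
    c * d ≤ a * b := by
  zify at *
  rw [show (d : ℤ) = a + b - c by linarith]
  rcases (by lia : (a : ℤ) = b ∨ (a : ℤ) = b + 1) with h | h
  · rw [h]; nlinarith [sq_nonneg ((c : ℤ) - b)]
  · rw [h]
    rcases le_or_gt (c : ℤ) b with h' | h'
    · nlinarith
    · nlinarith

end Quadratic

/-! ### Weights for the cuts of a complement -/

section Weights

/-- The entry, in absolute value, of the `-ρ`-eigenvector of `K_{a,b}` minus a `k`-matching at a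
vertex of the part of size `a`, where `m` says whether the vertex is matched. The eigenvector is
scaled so that its entries are polynomials; the size `b` enters only through the equation for `ρ`. -/
noncomputable def leftWeight (a k ρ : ℝ) (m : Prop) [Decidable m] : ℝ :=
  if m then ρ * (ρ ^ 2 - a + k) else ρ * (ρ ^ 2 + k - 1)

/-- The analogue of `leftWeight` for the part of size `b`; `a` is still the size of the other
part. -/
noncomputable def rightWeight (a k ρ : ℝ) (m : Prop) [Decidable m] : ℝ :=
  if m then (a - 1) * ρ ^ 2 else a * ρ ^ 2 - a + k

/-- The bipartite graph has degrees at most `d` on `L` and at most `#L` on `Lᶜ`; with weight `ρ` on `L`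
and `#L` on `Lᶜ` both inequalities follow from `#L * d ≤ ρ ^ 2`. -/
theorem hasCutWeights_of_card_mul_le {V : Type*} [Fintype V] {G : SimpleGraph V}
    [∀ v, Fintype (G.neighborSet v)] {ρ : ℝ} (hρ : 0 ≤ ρ) {d : ℕ}
    (hd : ∀ v, G.degree v ≤ d) {L : Finset V} (h : ((L.card * d : ℕ) : ℝ) ≤ ρ ^ 2) :
    G.HasCutWeights ρ L := by
  classical
  rcases Nat.eq_zero_or_pos (L.card * d) with h0 | h0
  -- there are no edges across the cut
  · refine ⟨fun _ => 1, fun _ => one_pos, fun u => ?_⟩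
    rw [Finset.filter_false_of_mem, Finset.sum_empty]
    · linarith
    rintro v - ⟨hadj, huv⟩
    rcases Nat.mul_eq_zero.1 h0 with hL | rfl
    · rw [Finset.card_eq_zero] at hL
      simp [hL] at huv
    · have : 0 < G.degree u := (G.degree_pos_iff_exists_adj u).2 ⟨v, hadj⟩
      exact absurd (hd u) (by omega)
  · have hL : 0 < L.card := pos_of_mul_pos_left h0 (Nat.zero_le _)
    have hρ' : 0 < ρ := by
      refine hρ.lt_of_ne' fun h' => ?_
      rw [h'] at h
      have : (1 : ℝ) ≤ ((L.card * d : ℕ) : ℝ) := by exact_mod_cast h0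
      linarith
    have hL' : (0 : ℝ) < L.card := by exact_mod_cast hL
    refine ⟨fun v => if v ∈ L then ρ else L.card, fun v => by
      dsimp only; split_ifs <;> assumption, fun u => ?_⟩
    dsimp only
    by_cases hu : u ∈ L
    · have h1 : (Finset.univ.filter fun v => G.Adj u v ∧ (u ∈ L ↔ v ∉ L)).card ≤ d := by
        refine (Finset.card_le_card fun v hv => ?_).trans
          ((G.card_neighborFinset_eq_degree u).trans_le (hd u))
        exact (mem_neighborFinset _ _ _).2 (Finset.mem_filter.1 hv).2.1
      rw [Finset.sum_congr rfl fun v hv => if_neg ((Finset.mem_filter.1 hv).2.2.1 hu),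
        Finset.sum_const, nsmul_eq_mul, if_pos hu]
      have h1' : ((Finset.univ.filter fun v => G.Adj u v ∧ (u ∈ L ↔ v ∉ L)).card : ℝ) ≤ d := by
        exact_mod_cast h1
      push_cast at h
      nlinarith
    · have h1 : (Finset.univ.filter fun v => G.Adj u v ∧ (u ∈ L ↔ v ∉ L)).card ≤ L.card := by
        refine Finset.card_le_card fun v hv => ?_
        have := (Finset.mem_filter.1 hv).2.2
        tauto
      rw [Finset.sum_congr rfl fun v hv => if_pos (not_not.1 (mt
        (Finset.mem_filter.1 hv).2.2.2 hu)), Finset.sum_const, nsmul_eq_mul, if_neg hu, mul_comm ρ]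
      exact mul_le_mul_of_nonneg_right (by exact_mod_cast h1) hρ

open Classical in
/-- If `G` has a `k`-matching across `(L, Lᶜ)`, the edges of `Gᶜ` across the cut lie in a complete
bipartite graph minus that matching. The weights below turn the inequality at a vertex of `L` into
`h`, and the one at a vertex of `Lᶜ` into an identity. -/
theorem hasCutWeights_compl_of_matching {V : Type*} [Fintype V] {G : SimpleGraph V} {k : ℕ}
    {L : Finset V} (p q : Fin k ↪ V) (hp : ∀ i, p i ∈ L) (hq : ∀ i, q i ∉ L)
    (hpq : ∀ i, G.Adj (p i) (q i)) (hk : 1 ≤ k) (hL : 2 ≤ L.card) {ρ : ℝ} (hρ : 1 ≤ ρ)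
    (hLρ : (L.card : ℝ) - k < ρ ^ 2)
    (h : 0 ≤ (ρ ^ 2) ^ 2 - ((L.card : ℝ) * Lᶜ.card - 2 * k + 1) * ρ ^ 2 +
      ((L.card : ℝ) - k) * (Lᶜ.card - k)) :
    Gᶜ.HasCutWeights ρ L := by
  set a : ℝ := (L.card : ℝ) with ha
  set b : ℝ := (Lᶜ.card : ℝ) with hb
  set P := Finset.univ.map p with hP
  set Q := Finset.univ.map q with hQ
  have hPL : P ⊆ L := fun v hv => by
    obtain ⟨i, _, rfl⟩ := Finset.mem_map.1 hv
    exact hp i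
  have hQL : Q ⊆ Lᶜ := fun v hv => by
    obtain ⟨i, _, rfl⟩ := Finset.mem_map.1 hv
    exact Finset.mem_compl.2 (hq i)
  have hPc : P.card = k := by simp [hP]
  have hQc : Q.card = k := by simp [hQ]
  have hsum : ∀ {A B : Finset V} (_ : B ⊆ A) (_ : B.card = k) (s t : ℝ),
      ∑ v ∈ A, (if v ∈ B then s else t) = k * s + (A.card - k) * t := by
    intro A B hBA hB s t
    rw [← Finset.sum_sdiff hBA, Finset.sum_congr rfl fun v hv => if_pos hv,
      Finset.sum_congr rfl fun v hv => if_neg (Finset.mem_sdiff.1 hv).2, Finset.sum_const,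
      Finset.sum_const, nsmul_eq_mul, nsmul_eq_mul, Finset.cast_card_sdiff hBA, hB]
    ring
  have hk' : (1 : ℝ) ≤ k := by exact_mod_cast hk
  have ha2 : (2 : ℝ) ≤ a := by rw [ha]; exact_mod_cast hL
  have hρ2 : 1 ≤ ρ ^ 2 := one_le_pow₀ hρ
  have hl : ∀ v, 0 < leftWeight a k ρ (v ∈ P) := fun v => by
    unfold leftWeight
    split_ifs <;> exact mul_pos (by linarith) (by linarith)
  have hr : ∀ v, 0 < rightWeight a k ρ (v ∈ Q) := fun v => by
    unfold rightWeight
    split_ifs <;> nlinarith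
  refine ⟨fun v => if v ∈ L then leftWeight a k ρ (v ∈ P) else rightWeight a k ρ (v ∈ Q),
    fun v => ?_, fun u => ?_⟩
  · dsimp only
    split_ifs
    exacts [hl v, hr v]
  dsimp only
  by_cases hu : u ∈ L
  · have hle : ∑ v with Gᶜ.Adj u v ∧ (u ∈ L ↔ v ∉ L),
        (if v ∈ L then leftWeight a k ρ (v ∈ P) else rightWeight a k ρ (v ∈ Q)) ≤
        k * ((a - 1) * ρ ^ 2) + (b - k) * (a * ρ ^ 2 - a + k) -
          if u ∈ P then (a - 1) * ρ ^ 2 else 0 := by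
      rw [Finset.sum_congr rfl fun v hv => if_neg ((Finset.mem_filter.1 hv).2.2.1 hu),
        ← hsum hQL hQc, le_sub_iff_add_le]
      split_ifs with huP
      · obtain ⟨i, _, rfl⟩ := Finset.mem_map.1 huP
        have hmem : q i ∈ Lᶜ := Finset.mem_compl.2 (hq i)
        rw [← Finset.sum_erase_add _ _ hmem, if_pos (Finset.mem_map_of_mem _ (Finset.mem_univ _))]
        refine add_le_add_left (Finset.sum_le_sum_of_subset_of_nonneg (fun v hv => ?_)
          fun v _ _ => (hr v).le) _
        obtain ⟨_, hadj, huv⟩ := Finset.mem_filter.1 hv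
        refine Finset.mem_erase.2 ⟨?_, Finset.mem_compl.2 (huv.1 hu)⟩
        rintro rfl
        exact ((compl_adj _ _ _).1 hadj).2 (hpq i)
      · rw [add_zero]
        refine Finset.sum_le_sum_of_subset_of_nonneg (fun v hv => ?_) fun v _ _ => (hr v).le
        exact Finset.mem_compl.2 ((Finset.mem_filter.1 hv).2.2.1 hu)
    refine (le_of_eq (by congr!)).trans (hle.trans ?_)
    rw [if_pos hu, leftWeight]
    split_ifs <;> linarith
  · have hle : ∑ v with Gᶜ.Adj u v ∧ (u ∈ L ↔ v ∉ L),
        (if v ∈ L then leftWeight a k ρ (v ∈ P) else rightWeight a k ρ (v ∈ Q)) ≤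
        k * (ρ * (ρ ^ 2 - a + k)) + (a - k) * (ρ * (ρ ^ 2 + k - 1)) -
          if u ∈ Q then ρ * (ρ ^ 2 - a + k) else 0 := by
      rw [Finset.sum_congr rfl fun v hv => if_pos (not_not.1 (mt
        (Finset.mem_filter.1 hv).2.2.2 hu)), ← hsum hPL hPc, le_sub_iff_add_le]
      split_ifs with huQ
      · obtain ⟨i, _, rfl⟩ := Finset.mem_map.1 huQ
        rw [← Finset.sum_erase_add _ _ (hp i), if_pos (Finset.mem_map_of_mem _ (Finset.mem_univ _))]
        refine add_le_add_left (Finset.sum_le_sum_of_subset_of_nonneg (fun v hv => ?_)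
          fun v _ _ => (hl v).le) _
        obtain ⟨_, hadj, huv⟩ := Finset.mem_filter.1 hv
        refine Finset.mem_erase.2 ⟨?_, not_not.1 (mt huv.2 hu)⟩
        rintro rfl
        exact ((compl_adj _ _ _).1 hadj).2 (hpq i).symm
      · rw [add_zero]
        refine Finset.sum_le_sum_of_subset_of_nonneg (fun v hv => ?_) fun v _ _ => (hl v).le
        exact not_not.1 (mt (Finset.mem_filter.1 hv).2.2.2 hu)
    refine (le_of_eq (by congr!)).trans (hle.trans (le_of_eq ?_))
    rw [if_neg hu, rightWeight]
    split_ifs <;> ring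

end Weights

/-! ### The eigenvector of the extremal graph -/

/-- The vector equal to `leftWeight` on the first clique and to `-rightWeight` on the second is an
eigenvector for `-ρ`; the hypothesis `h` is exactly the eigenvalue equation at a matched or an
unmatched vertex of the first clique, while the equations on the second clique are identities. -/
theorem leastEigenvalue_compl_cliquesWithMatching_le {a b k : ℕ} (ha : k ≤ a) (hb : k ≤ b)
    (hk : 1 ≤ k) (ha2 : 2 ≤ a) {ρ : ℝ} (hρ : ρ ≠ 0)
    (h : (ρ ^ 2) ^ 2 - (a * b - 2 * k + 1) * ρ ^ 2 + (a - k) * (b - k) = 0) :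
    (cliquesWithMatching a b k)ᶜ.leastEigenvalue ≤ -ρ := by
  classical
  let x : Fin a ⊕ Fin b → ℝ := Sum.elim
    (fun i => leftWeight a k ρ (i.1 < k)) (fun j => - rightWeight a k ρ (j.1 < k))
  -- sums over one clique of functions that depend only on whether the vertex is matched
  have hsplit : ∀ {m : ℕ} (_ : k ≤ m) (s t : ℝ),
      ∑ j : Fin m, (if j.1 < k then s else t) = k * s + (m - k) * t := by
    intro m hm s t
    rw [Fin.sum_univ_eq_sum_range (fun j => if j < k then s else t) m,
      ← Finset.sum_range_add_sum_Ico _ hm,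
      Finset.sum_congr rfl fun j hj => if_pos (Finset.mem_range.1 hj),
      Finset.sum_congr rfl fun j hj => if_neg (not_lt.2 (Finset.mem_Ico.1 hj).1)]
    simp [Nat.cast_sub hm]
  -- the neighbours of `i` in the complement are the whole opposite clique, less its partner
  have hex : ∀ {m m' : ℕ} (_ : k ≤ m') (i : Fin m) (y : ℕ → ℝ),
      ∑ j : Fin m', (if i.1 = j.1 ∧ i.1 < k then 0 else y j.1) =
        ∑ j : Fin m', y j.1 - if i.1 < k then y i.1 else 0 := by
    intro m m' hm i y
    rw [eq_sub_iff_add_eq]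
    split_ifs with hi
    · rw [← Finset.sum_erase_add _ _ (Finset.mem_univ (⟨i.1, hi.trans_le hm⟩ : Fin m')),
        ← Finset.sum_erase_add Finset.univ (fun j : Fin m' => y j.1)
          (Finset.mem_univ (⟨i.1, hi.trans_le hm⟩ : Fin m'))]
      simp only [hi, and_self, if_true, add_zero]
      congr 1
      refine Finset.sum_congr rfl fun j hj => if_neg fun h => ?_
      exact (Finset.mem_erase.1 hj).1 (Fin.ext h.1.symm)
    · simp [hi]
  have hll : ∀ i j : Fin a, ¬ (cliquesWithMatching a b k)ᶜ.Adj (.inl i) (.inl j) := by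
    intro i j h
    rw [compl_adj] at h
    exact h.2 fun hij => h.1 (congrArg _ hij)
  have hrr : ∀ i j : Fin b, ¬ (cliquesWithMatching a b k)ᶜ.Adj (.inr i) (.inr j) := by
    intro i j h
    rw [compl_adj] at h
    exact h.2 fun hij => h.1 (congrArg _ hij)
  have hlr : ∀ (i : Fin a) (j : Fin b), (cliquesWithMatching a b k)ᶜ.Adj (.inl i) (.inr j) ↔
      ¬ (i.1 = j.1 ∧ i.1 < k) := by
    intro i j
    rw [compl_adj]
    exact and_iff_right (by simp)
  have hrl : ∀ (i : Fin a) (j : Fin b), (cliquesWithMatching a b k)ᶜ.Adj (.inr j) (.inl i) ↔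
      ¬ (j.1 = i.1 ∧ j.1 < k) := by
    intro i j
    rw [adj_comm, hlr, eq_comm]
    exact not_congr (and_congr_right fun h => by rw [h])
  refine leastEigenvalue_le_of_mulVec_eq (x := x) (fun hx => ?_) (funext ?_)
  · have := congrFun hx (.inr ⟨0, by omega⟩)
    have ha' : (2 : ℝ) ≤ a := by exact_mod_cast ha2
    have h0 : 0 < k := by omega
    have hρ2 : 0 < ρ ^ 2 := by positivity
    simp only [x, Sum.elim_inr, rightWeight, h0, if_true, Pi.zero_apply] at this
    nlinarith
  · rintro (i | j)
    · simp only [Matrix.mulVec, dotProduct, Fintype.sum_sum_type, adjMatrix_apply, hll, hlr, x,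
        Sum.elim_inl, Sum.elim_inr, if_false, zero_mul, Finset.sum_const_zero, zero_add,
        ite_not, ite_mul, one_mul, Pi.smul_apply, smul_eq_mul]
      rw [hex hb i fun j => - rightWeight a k ρ (j < k)]
      simp only [leftWeight, rightWeight, Finset.sum_neg_distrib, hsplit hb]
      split_ifs <;> linear_combination h
    · simp only [Matrix.mulVec, dotProduct, Fintype.sum_sum_type, adjMatrix_apply, hrr, hrl, x,
        Sum.elim_inl, Sum.elim_inr, if_false, zero_mul, Finset.sum_const_zero, add_zero,
        ite_not, ite_mul, one_mul, Pi.smul_apply, smul_eq_mul]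
      rw [hex ha j fun j => leftWeight a k ρ (j < k)]
      simp only [leftWeight, rightWeight, hsplit ha]
      split_ifs <;> ring

/-- The case `n = 2`, where the eigenvector of `leastEigenvalue_compl_cliquesWithMatching_le`
vanishes. -/
theorem leastEigenvalue_compl_cliquesWithMatching_one :
    (cliquesWithMatching 1 1 1)ᶜ.leastEigenvalue ≤ 0 := by
  classical
  have h : (cliquesWithMatching 1 1 1)ᶜ = ⊥ := by
    refine eq_bot_iff.2 fun u v huv => ?_
    rw [compl_adj] at huv
    rcases u with i | i <;> rcases v with j | j
    · exact huv.1 (congrArg _ (Subsingleton.elim i j))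
    · exact huv.2 ⟨by omega, by omega⟩
    · exact huv.2 ⟨by omega, by omega⟩
    · exact huv.1 (congrArg _ (Subsingleton.elim i j))
  rw [h]
  refine leastEigenvalue_le_of_mulVec_eq (x := 1) one_ne_zero ?_
  ext u
  simp [Matrix.mulVec, dotProduct]

/-! ### The bound for a graph of given connectivity -/

/-- Here `P` is an upper bound for `s * t` over `s + t = n`, and `h` says that `ρ ^ 2` is a root of
the quadratic `X² - (st - 2k + 1)X + (s - k)(t - k)` with `st` replaced by `P`. -/
theorem neg_le_leastEigenvalue_compl {V : Type*} [Fintype V] {G : SimpleGraph V} {n k P : ℕ}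
    (hn : Fintype.card V = n) (hk : 1 ≤ k) (hkn : 2 * k ≤ n) (hG : k ≤ G.vertexConnectivity)
    {ρ : ℝ} (hρ : 0 ≤ ρ) (hP : ∀ s t : ℕ, s + t = n → s * t ≤ P)
    (hle : (k : ℝ) * (n - k - 2) + 1 ≤ ρ ^ 2)
    (h : (ρ ^ 2) ^ 2 - (P - 2 * k + 1) * ρ ^ 2 + (P - k * n + k ^ 2) = 0) :
    -ρ ≤ Gᶜ.leastEigenvalue := by
  classical
  have hkR : (1 : ℝ) ≤ k := by exact_mod_cast hk
  have hknR : 2 * (k : ℝ) ≤ n := by exact_mod_cast hkn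
  have hdeg : ∀ v, Gᶜ.degree v ≤ n - k - 1 := fun v => by
    have := hG.trans (vertexConnectivity_le_degree v)
    rw [degree_compl, hn]
    convert (by omega : n - 1 - G.degree v ≤ n - k - 1)
  have hcast : ((n - k - 1 : ℕ) : ℝ) = n - k - 1 := by
    rw [Nat.sub_sub, Nat.cast_sub (by omega)]
    push_cast
    ring
  -- parts too large for the degree bound have at least `k` and at least two vertices
  have hlarge : ∀ s : ℕ, ¬ ((s * (n - k - 1) : ℕ) : ℝ) ≤ ρ ^ 2 → k ≤ s ∧ 2 ≤ s := by
    intro s hs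
    by_contra! hcon
    refine hs (le_trans ?_ hle)
    rw [Nat.cast_mul, hcast]
    by_cases hsk : s + 1 ≤ k
    · have hsk' : (s : ℝ) + 1 ≤ k := by exact_mod_cast hsk
      have := mul_le_mul_of_nonneg_right hsk' (by linarith : (0 : ℝ) ≤ n - k - 1)
      linarith
    · have hs1 : s ≤ 1 := by
        by_contra hs1
        exact absurd (hcon (by omega)) (by omega)
      obtain rfl : k = 1 := by omega
      obtain rfl : s = 1 := by omega
      push_cast
      linarith
  refine neg_le_leastEigenvalue_of_hasCutWeights hρ fun L => ?_
  by_cases h1 : ((L.card * (n - k - 1) : ℕ) : ℝ) ≤ ρ ^ 2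
  · exact hasCutWeights_of_card_mul_le hρ hdeg h1
  by_cases h2 : ((Lᶜ.card * (n - k - 1) : ℕ) : ℝ) ≤ ρ ^ 2
  · exact (hasCutWeights_of_card_mul_le hρ hdeg h2).of_compl
  obtain ⟨hLk, hL2⟩ := hlarge _ h1
  obtain ⟨hRk, hR2⟩ := hlarge _ h2
  have hLR : L.card + Lᶜ.card = n := by rw [Finset.card_add_card_compl, hn]
  obtain ⟨p, q, hp, hq, hpq⟩ := exists_matching_of_le_vertexConnectivity hG hLk hRk
  have hLRR : (L.card : ℝ) + Lᶜ.card = n := by exact_mod_cast hLR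
  have hLkR : (k : ℝ) ≤ L.card := by exact_mod_cast hLk
  have hRkR : (k : ℝ) ≤ Lᶜ.card := by exact_mod_cast hRk
  have hL2R : (2 : ℝ) ≤ L.card := by exact_mod_cast hL2
  have hR2R : (2 : ℝ) ≤ Lᶜ.card := by exact_mod_cast hR2
  have hPR : (L.card : ℝ) * Lᶜ.card ≤ P := by exact_mod_cast hP _ _ hLR
  have hkn2 : (0 : ℝ) ≤ n - k - 2 := by
    have : k + 2 ≤ n := by omega
    have : (k : ℝ) + 2 ≤ n := by exact_mod_cast this
    linarith
  have hρ1 : 1 ≤ ρ ^ 2 := by nlinarith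
  refine hasCutWeights_compl_of_matching p q hp hq hpq hk hL2
    ((one_le_sq_iff₀ hρ).1 hρ1) ?_ ?_
  · nlinarith [mul_nonneg (by linarith : (0 : ℝ) ≤ k - 1) hkn2]
  -- replacing `P` by `s * t ≤ P` increases the quadratic at `ρ ^ 2 ≥ 1`
  · have hnn := mul_nonneg (sub_nonneg.2 hPR) (sub_nonneg.2 hρ1)
    have : ((L.card : ℝ) - k) * (Lᶜ.card - k) = L.card * Lᶜ.card - k * n + k ^ 2 := by
      rw [← hLRR]; ring
    rw [this]
    linarith

end SimpleGraph

theorem theorem3p2 (n κ : ℕ) (hκ : 1 ≤ κ) (hn : 2 * κ ≤ n) :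
    ((SimpleGraph.cliquesWithMatching ((n + 1) / 2) (n / 2) κ).Connected ∧
      (SimpleGraph.cliquesWithMatching ((n + 1) / 2) (n / 2) κ).vertexConnectivity = κ) ∧
    ∀ (V : Type*) [Fintype V] (G : SimpleGraph V),
      Fintype.card V = n → G.Connected → G.vertexConnectivity = κ →
        (SimpleGraph.cliquesWithMatching ((n + 1) / 2) (n / 2) κ)ᶜ.leastEigenvalue ≤
          Gᶜ.leastEigenvalue := by
  have ha : κ ≤ (n + 1) / 2 := by omega
  have hb : κ ≤ n / 2 := by omega
  have hba : n / 2 ≤ (n + 1) / 2 := by omega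
  refine ⟨⟨SimpleGraph.cliquesWithMatching_connected ha hb hκ,
    (SimpleGraph.vertexConnectivity_cliquesWithMatching_le ha hb hκ hba).antisymm
      (SimpleGraph.le_vertexConnectivity_cliquesWithMatching ha hb hκ)⟩, ?_⟩
  intro V _ G hV _ hG
  obtain ⟨a, ha'⟩ : ∃ a, (n + 1) / 2 = a := ⟨_, rfl⟩
  obtain ⟨b, hb'⟩ : ∃ b, n / 2 = b := ⟨_, rfl⟩
  rw [ha', hb']
  rw [ha'] at ha
  rw [hb'] at hb
  have hab : a + b = n := by omega
  have hP : ∀ s t : ℕ, s + t = n → s * t ≤ a * b := fun s t hst =>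
    SimpleGraph.mul_le_mul_of_balanced (by omega) (by omega) (by omega)
  have habR : (a : ℝ) + b = n := by exact_mod_cast hab
  have hκR : (1 : ℝ) ≤ κ := by exact_mod_cast hκ
  -- up to sign, the value at `κ (n - κ - 2) + 1` of the quadratic whose root is `ρ ^ 2`; that point
  -- is itself a root of the quadratic belonging to the parts `κ` and `n - κ`
  have hnn : (0 : ℝ) ≤ (κ : ℝ) * (n - κ - 2) * (a * b - κ * (n - κ)) := by
    have h1 : (κ : ℝ) * (n - κ) ≤ a * b := by
      have := hP κ (n - κ) (by omega)
      rw [← Nat.cast_sub (by omega)]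
      exact_mod_cast this
    rcases Nat.lt_or_ge n 3 with h3 | h3
    · obtain rfl : n = 2 := by omega
      obtain rfl : κ = 1 := by omega
      obtain rfl : a = 1 := by omega
      obtain rfl : b = 1 := by omega
      norm_num
    · have : κ + 2 ≤ n := by omega
      have : (κ : ℝ) + 2 ≤ n := by exact_mod_cast this
      exact mul_nonneg (mul_nonneg (by linarith) (by linarith)) (by linarith)
  obtain ⟨θ, hle, hθ⟩ := SimpleGraph.exists_quadratic_root_ge (q := (a : ℝ) * b - 2 * κ + 1)
    (c := a * b - κ * n + κ ^ 2) (t := κ * (n - κ - 2) + 1) (by linarith)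
  have hθ0 : 0 ≤ θ := by
    have : 2 * (κ : ℝ) ≤ n := by exact_mod_cast hn
    nlinarith [mul_nonneg (by linarith : (0 : ℝ) ≤ κ) (by linarith : (0 : ℝ) ≤ n - 2 * κ)]
  obtain ⟨ρ, hρ, rfl⟩ : ∃ ρ : ℝ, 0 ≤ ρ ∧ ρ ^ 2 = θ := ⟨√θ, Real.sqrt_nonneg _, Real.sq_sqrt hθ0⟩
  refine le_trans ?_ (SimpleGraph.neg_le_leastEigenvalue_compl hV hκ hn hG.ge hρ hP hle
    (by push_cast; exact hθ))
  rcases Nat.lt_or_ge n 3 with h3 | h3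
  · obtain rfl : n = 2 := by omega
    obtain rfl : κ = 1 := by omega
    obtain rfl : a = 1 := by omega
    obtain rfl : b = 1 := by omega
    have : ρ = 0 := by
      norm_num at hθ
      exact hθ
    rw [this, neg_zero]
    exact SimpleGraph.leastEigenvalue_compl_cliquesWithMatching_one
  · refine SimpleGraph.leastEigenvalue_compl_cliquesWithMatching_le ha hb hκ (by omega) ?_ ?_
    · rintro rfl
      have : κ + 2 ≤ n := by omega
      have : (κ : ℝ) + 2 ≤ n := by exact_mod_cast this
      nlinarith
    · rw [← habR] at hθ
      linarith
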